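/- Let $\mathbb{D}=\{z\in\mathbb{C}:|z|<1\}$, let $v(z)=1$ if $|z|\le 1-1/e$ and $v(z)=(-\log(1-|z|))^{-1}$ if $1-1/e\le |z|<1$. For $k\in\{1,2,\dots\}$ let $H^\infty_{v^k}$ be the Banach space of all analytic functions $f$ on $\mathbb{D}$ with $\|f\|_{k}:=\sup_{z\in\mathbb{D}}v(z)^k|f(z)|<\infty$. Let $VH(\mathbb{D})=\bigcup_{k\ge 1}H^\infty_{v^k}$, endowed with the finest locally convex topology for which all inclusions $H^\infty_{v^k}\subset VH(\mathbb{D})$ are continuous. For $t\in[0,1)$ let $C_t\colon VH(\mathbb{D})\to VH(\mathbb{D})$ be the continuous linear operator given by $$C_tf(0)=f(0),\qquad C_tf(z)=\frac1z\int_0^z\frac{f(\zeta)}{1-t\zeta}\,d\zeta\quad(z\in\mathbb{D}\setminus\{0\}).$$ The point spectrum $\sigma_{pt}(C_t,VH(\mathbb{D}))$ is the set of all $\lambda\in\mathbb{C}$ for which $\lambda I-C_t$ is not injective, and the spectrum $\sigma(C_t,VH(\mathbb{D}))$ is the set of all $\lambda\in\mathbb{C}$ for which $\lambda I-C_t$ has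 no inverse in the algebra of continuous linear operators on $VH(\mathbb{D})$. Proposition. For each $t\in[0,1)$, (i) $\sigma_{pt}(C_t,VH(\mathbb{D}))=\left\{\frac{1}{m+1}:m=0,1,2,\dots\right\}$; (ii) $\sigma(C_t,VH(\mathbb{D}))=\left\{\frac{1}{m+1}:m=0,1,2,\dots\right\}\cup\{0\}$. -/

import Mathlib

namespace LogGrowth

noncomputable section

/-- The space of holomorphic functions on the open unit disc. A function on the disc is
represented by its extension by zero to the whole plane. -/
def holo : Submodule ℂ (ℂ → ℂ) where
  carrier := {f | DifferentiableOn ℂ f (Metric.ball 0 1) ∧ ∀ z ∉ Metric.ball (0 : ℂ) 1, f z = 0}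
  add_mem' := by
    rintro f g ⟨hf, hf0⟩ ⟨hg, hg0⟩
    exact ⟨hf.add hg, fun z hz => by simp [hf0 z hz, hg0 z hz]⟩
  zero_mem' := ⟨differentiableOn_const 0, fun _ _ => rfl⟩
  smul_mem' := by
    rintro c f ⟨hf, hf0⟩
    exact ⟨hf.const_smul c, fun z hz => by simp [hf0 z hz]⟩

/-- The logarithmic weight: `1` if `|z| ≤ 1 - 1/e`, and `(-log (1 - |z|))⁻¹` otherwise.
Only its values on the open unit disc are used. -/
def weight (z : ℂ) : ℝ :=
  if ‖z‖ ≤ 1 - 1 / Real.exp 1 then 1 else (-Real.log (1 - ‖z‖))⁻¹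

theorem one_le_neg_log {r : ℝ} (h : 1 - 1 / Real.exp 1 ≤ r) (h1 : r < 1) :
    1 ≤ -Real.log (1 - r) := by
  have h2 : Real.log (1 - r) ≤ Real.log (1 / Real.exp 1) :=
    Real.log_le_log (by linarith) (by linarith)
  rw [one_div, Real.log_inv, Real.log_exp] at h2
  linarith

theorem weight_pos {z : ℂ} (hz : z ∈ Metric.ball (0 : ℂ) 1) : 0 < weight z := by
  rw [mem_ball_zero_iff] at hz
  unfold weight
  split_ifs with h
  · exact one_pos
  · have := one_le_neg_log (not_le.1 h).le hz
    exact inv_pos.2 (by linarith)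

theorem weight_le_one {z : ℂ} (hz : z ∈ Metric.ball (0 : ℂ) 1) : weight z ≤ 1 := by
  rw [mem_ball_zero_iff] at hz
  unfold weight
  split_ifs with h
  · exact le_rfl
  · exact inv_le_one_of_one_le₀ (one_le_neg_log (not_le.1 h).le hz)

theorem weight_anti {w z : ℂ} (hwz : ‖w‖ ≤ ‖z‖) (hz : z ∈ Metric.ball (0 : ℂ) 1) :
    weight z ≤ weight w := by
  have hz' := hz
  rw [mem_ball_zero_iff] at hz
  by_cases h : ‖w‖ ≤ 1 - 1 / Real.exp 1
  · have : weight w = 1 := by simp only [weight, if_pos h]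
    rw [this]
    exact weight_le_one hz'
  · have h' : ¬ ‖z‖ ≤ 1 - 1 / Real.exp 1 := fun h2 => h (hwz.trans h2)
    have h3 := one_le_neg_log (not_le.1 h).le (lt_of_le_of_lt hwz hz)
    simp only [weight, if_neg h, if_neg h']
    apply inv_anti₀ (by linarith)
    have := Real.log_le_log (x := 1 - ‖z‖) (y := 1 - ‖w‖) (by linarith) (by linarith)
    linarith

/-- The holomorphic functions `f` on the disc for which `weight ^ k * |f|` is bounded. -/
def stepSubmodule (k : ℕ) : Submodule ℂ (ℂ → ℂ) where
  carrier := {f | f ∈ holo ∧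
    BddAbove (Set.range fun z : Metric.ball (0 : ℂ) 1 => weight z ^ k * ‖f z‖)}
  add_mem' := by
    rintro f g ⟨hf, B, hB⟩ ⟨hg, C, hC⟩
    refine ⟨holo.add_mem hf hg, B + C, ?_⟩
    rintro _ ⟨z, rfl⟩
    have h1 : weight z ^ k * ‖f z‖ ≤ B := hB ⟨z, rfl⟩
    have h2 : weight z ^ k * ‖g z‖ ≤ C := hC ⟨z, rfl⟩
    have h3 : 0 ≤ weight (z : ℂ) ^ k := pow_nonneg (weight_pos z.2).le k
    have := mul_le_mul_of_nonneg_left (norm_add_le (f z) (g z)) h3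
    simp only [Pi.add_apply]
    linarith
  zero_mem' := by
    refine ⟨holo.zero_mem, 0, ?_⟩
    rintro _ ⟨z, rfl⟩
    simp
  smul_mem' := by
    rintro c f ⟨hf, B, hB⟩
    refine ⟨holo.smul_mem c hf, ‖c‖ * B, ?_⟩
    rintro _ ⟨z, rfl⟩
    have h1 : weight z ^ k * ‖f z‖ ≤ B := hB ⟨z, rfl⟩
    have := mul_le_mul_of_nonneg_left h1 (norm_nonneg c)
    simp only [Pi.smul_apply, norm_smul]
    linarith

/-- The weighted Banach space of holomorphic functions for the weight `weight ^ k`. It is a type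
of its own, so that it carries the weighted sup norm and not the topology of `ℂ → ℂ`. -/
def Step (k : ℕ) : Type := stepSubmodule k

namespace Step

variable {k : ℕ}

instance : AddCommGroup (Step k) := inferInstanceAs (AddCommGroup (stepSubmodule k))

instance : Module ℂ (Step k) := inferInstanceAs (Module ℂ (stepSubmodule k))

/-- The underlying function. -/
def toFun (f : Step k) : ℂ → ℂ := f.1

/-- The weighted sup norm, the supremum of `weight z ^ k * |f z|` over the unit disc. -/
instance : Norm (Step k) :=
  ⟨fun f => ⨆ z : Metric.ball (0 : ℂ) 1, weight z ^ k * ‖f.toFun z‖⟩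

theorem le_norm (f : Step k) {z : ℂ} (hz : z ∈ Metric.ball (0 : ℂ) 1) :
    weight z ^ k * ‖f.toFun z‖ ≤ ‖f‖ :=
  le_ciSup (f := fun z : Metric.ball (0 : ℂ) 1 => weight z ^ k * ‖f.toFun z‖) f.2.2 ⟨z, hz⟩

theorem norm_le {f : Step k} {C : ℝ}
    (h : ∀ z ∈ Metric.ball (0 : ℂ) 1, weight z ^ k * ‖f.toFun z‖ ≤ C) : ‖f‖ ≤ C := by
  have : Nonempty (Metric.ball (0 : ℂ) 1) := ⟨⟨0, by simp⟩⟩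
  exact ciSup_le fun z => h z z.2

theorem norm_nonneg' (f : Step k) : 0 ≤ ‖f‖ := by
  have h0 : (0 : ℂ) ∈ Metric.ball (0 : ℂ) 1 := by simp
  exact le_trans (mul_nonneg (pow_nonneg (weight_pos h0).le k) (norm_nonneg _)) (le_norm f h0)

theorem norm_smul_le' (c : ℂ) (f : Step k) : ‖c • f‖ ≤ ‖c‖ * ‖f‖ := by
  refine norm_le fun z hz => ?_
  have h1 := mul_le_mul_of_nonneg_left (le_norm f hz) (norm_nonneg c)
  have h2 : (c • f).toFun z = c * f.toFun z := rfl
  rw [h2, norm_mul]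
  linarith

theorem core : NormedSpace.Core ℂ (Step k) where
  norm_nonneg := norm_nonneg'
  norm_smul c f := by
    refine le_antisymm (norm_smul_le' c f) ?_
    by_cases hc : c = 0
    · subst hc
      simpa using norm_nonneg' ((0 : ℂ) • f)
    · have h := norm_smul_le' c⁻¹ (c • f)
      rw [inv_smul_smul₀ hc, norm_inv] at h
      have hc' : 0 < ‖c‖ := norm_pos_iff.2 hc
      have h2 := mul_le_mul_of_nonneg_left h hc'.le
      rwa [mul_inv_cancel_left₀ hc'.ne'] at h2
  norm_triangle f g := by
    refine norm_le fun z hz => ?_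
    have h3 : 0 ≤ weight z ^ k := pow_nonneg (weight_pos hz).le k
    have := mul_le_mul_of_nonneg_left (norm_add_le (f.toFun z) (g.toFun z)) h3
    have h2 : (f + g).toFun z = f.toFun z + g.toFun z := rfl
    rw [h2]
    linarith [le_norm f hz, le_norm g hz]
  norm_eq_zero_iff f := by
    constructor
    · intro h
      refine Subtype.ext (funext fun z => ?_)
      by_cases hz : z ∈ Metric.ball (0 : ℂ) 1
      · have h1 := le_norm f hz
        rw [h] at h1
        have h2 : 0 < weight z ^ k := pow_pos (weight_pos hz) k
        have h3 : ‖f.toFun z‖ ≤ 0 := by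
          by_contra h4
          exact absurd h1 (not_le.2 (mul_pos h2 (not_le.1 h4)))
        exact norm_le_zero_iff.1 h3
      · exact f.2.1.2 z hz
    · rintro rfl
      refine le_antisymm (norm_le fun z _ => ?_) (norm_nonneg' _)
      have : (0 : Step k).toFun z = 0 := rfl
      simp [this]

instance : NormedAddCommGroup (Step k) := NormedAddCommGroup.ofCore core

instance : NormedSpace ℂ (Step k) := NormedSpace.ofCore core

end Step

theorem stepSubmodule_mono {k l : ℕ} (h : k ≤ l) : stepSubmodule k ≤ stepSubmodule l := by
  rintro f ⟨hf, B, hB⟩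
  refine ⟨hf, B, ?_⟩
  rintro _ ⟨z, rfl⟩
  refine le_trans (mul_le_mul_of_nonneg_right ?_ (norm_nonneg _)) (hB ⟨z, rfl⟩)
  exact pow_le_pow_of_le_one (weight_pos z.2).le (weight_le_one z.2) h

/-- The union, over `k ≥ 1`, of the weighted spaces. -/
def vhSubmodule : Submodule ℂ (ℂ → ℂ) where
  carrier := {f | ∃ k, 1 ≤ k ∧ f ∈ stepSubmodule k}
  add_mem' := by
    rintro f g ⟨k, hk, hf⟩ ⟨l, _, hg⟩
    exact ⟨max k l, le_max_of_le_left hk, (stepSubmodule _).add_mem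
      (stepSubmodule_mono (le_max_left k l) hf) (stepSubmodule_mono (le_max_right k l) hg)⟩
  zero_mem' := ⟨1, le_rfl, (stepSubmodule 1).zero_mem⟩
  smul_mem' := by
    rintro c f ⟨k, hk, hf⟩
    exact ⟨k, hk, (stepSubmodule k).smul_mem c hf⟩

/-- The space `VH(𝔻)` of holomorphic functions of logarithmic growth on the unit disc. It is a
type of its own, so that it carries the inductive limit topology and not that of `ℂ → ℂ`. -/
def VH : Type := vhSubmodule

namespace VH

instance : AddCommGroup VH := inferInstanceAs (AddCommGroup vhSubmodule)

instance : Module ℂ VH := inferInstanceAs (Module ℂ vhSubmodule)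

/-- The underlying function. -/
def toFun (f : VH) : ℂ → ℂ := f.1

/-- The inclusion of a step of the union. -/
def incl (k : ℕ) (hk : 1 ≤ k) : Step k →ₗ[ℂ] VH where
  toFun f := ⟨f.1, k, hk, f.2⟩
  map_add' _ _ := rfl
  map_smul' _ _ := rfl

/-- The vector space topologies on `VH(𝔻)` that are locally convex and for which all inclusions
of the steps are continuous. -/
def admissible : Set (TopologicalSpace VH) :=
  {τ | @IsTopologicalAddGroup VH τ _ ∧ @ContinuousSMul ℂ VH _ _ τ ∧
    @LocallyConvexSpace ℝ VH _ _ _ _ τ ∧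
    ∀ (k : ℕ) (hk : 1 ≤ k), @Continuous (Step k) VH _ τ (incl k hk)}

/-- The inductive limit topology: the finest locally convex topology for which the inclusions of
the steps are continuous. In the order on topologies, finer means smaller. -/
instance : TopologicalSpace VH := sInf admissible

instance : IsTopologicalAddGroup VH := topologicalAddGroup_sInf fun _ h => h.1

instance : ContinuousSMul ℂ VH := continuousSMul_sInf fun _ h => h.2.1

instance : LocallyConvexSpace ℝ VH := .sInf fun _ h => h.2.2.1

theorem continuous_incl (k : ℕ) (hk : 1 ≤ k) : Continuous (incl k hk) :=
  continuous_sInf_rng.2 fun _ h => h.2.2.2 k hk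

/-- The infimum that defines the topology is attained: it is itself admissible, and it is finer
than every admissible topology. -/
theorem isLeast_admissible : IsLeast admissible (inferInstance : TopologicalSpace VH) :=
  ⟨⟨inferInstance, inferInstance, inferInstance, continuous_incl⟩, fun _ h => sInf_le h⟩

theorem continuous_of_incl {E : Type*} [AddCommGroup E] [Module ℂ E] [τ : TopologicalSpace E]
    [IsTopologicalAddGroup E] [ContinuousSMul ℂ E] [LocallyConvexSpace ℝ E] (T : VH →ₗ[ℂ] E)
    (h : ∀ (k : ℕ) (hk : 1 ≤ k), Continuous fun f : Step k => T (incl k hk f)) :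
    Continuous T := by
  rw [continuous_iff_le_induced]
  refine sInf_le ⟨topologicalAddGroup_induced T, continuousSMul_induced T,
    LocallyConvexSpace.induced (T.restrictScalars ℝ), fun k hk => ?_⟩
  rw [continuous_induced_rng]
  exact h k hk

/-- The inductive limit is a Hausdorff space. -/
instance : T2Space VH := by
  let ev : VH →ₗ[ℂ] (ℂ → ℂ) := vhSubmodule.subtype
  have hev : Continuous ev := by
    refine continuous_of_incl ev fun k hk => continuous_pi fun z => ?_
    by_cases hz : z ∈ Metric.ball (0 : ℂ) 1
    · let L : Step k →ₗ[ℂ] ℂ :=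
        { toFun := fun f => f.toFun z, map_add' := fun _ _ => rfl, map_smul' := fun _ _ => rfl }
      have hw : 0 < weight z ^ k := pow_pos (weight_pos hz) k
      have hL : ∀ f, ‖L f‖ ≤ (weight z ^ k)⁻¹ * ‖f‖ := fun f => by
        rw [inv_mul_eq_div, le_div_iff₀ hw, mul_comm]
        exact Step.le_norm f hz
      exact (L.mkContinuous _ hL).continuous
    · have : (fun f : Step k => ev (incl k hk f) z) = fun _ => 0 :=
        funext fun f => f.2.1.2 z hz
      rw [this]
      exact continuous_const
  exact T2Space.of_injective_continuous (f := ev) Subtype.val_injective hev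

end VH

/-- The generalized Cesàro operator on functions on the unit disc: `f 0` at the origin, and
`(1/z) ∫_0^z f ζ / (1 - t ζ) dζ` at the other points of the disc, the integral being taken
along the segment `ζ = s z`, `0 ≤ s ≤ 1`. The result is extended by zero outside the disc. -/
def cesaroFun (t : ℝ) (f : ℂ → ℂ) (z : ℂ) : ℂ :=
  open Classical in
  if z ∈ Metric.ball (0 : ℂ) 1 then
    if z = 0 then f 0
    else (1 / z) * ∫ s in (0 : ℝ)..1, f (s * z) / (1 - t * (s * z)) * z
  else 0

theorem cesaroFun_of_notMem (t : ℝ) (f : ℂ → ℂ) {z : ℂ} (hz : z ∉ Metric.ball (0 : ℂ) 1) :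
    cesaroFun t f z = 0 := by
  rw [cesaroFun, if_neg hz]

theorem cesaroFun_zero (t : ℝ) (f : ℂ → ℂ) : cesaroFun t f 0 = f 0 := by
  rw [cesaroFun, if_pos (by simp), if_pos rfl]

theorem cesaroFun_of_mem (t : ℝ) (f : ℂ → ℂ) {z : ℂ} (hz : z ∈ Metric.ball (0 : ℂ) 1)
    (h0 : z ≠ 0) : cesaroFun t f z =
      (1 / z) * ∫ s in (0 : ℝ)..1, f (s * z) / (1 - t * (s * z)) * z := by
  rw [cesaroFun, if_pos hz, if_neg h0]

theorem segment_norm_le {z : ℂ} {s : ℝ} (hs : s ∈ Set.Icc (0 : ℝ) 1) : ‖(s : ℂ) * z‖ ≤ ‖z‖ := by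
  rw [norm_mul, Complex.norm_real, Real.norm_eq_abs, abs_of_nonneg hs.1]
  exact mul_le_of_le_one_left (norm_nonneg z) hs.2

theorem segment_mem {z : ℂ} (hz : z ∈ Metric.ball (0 : ℂ) 1) {s : ℝ}
    (hs : s ∈ Set.Icc (0 : ℝ) 1) : (s : ℂ) * z ∈ Metric.ball (0 : ℂ) 1 := by
  rw [mem_ball_zero_iff] at hz ⊢
  exact lt_of_le_of_lt (segment_norm_le hs) hz

theorem denom_bound {t : ℝ} (ht : t ∈ Set.Ico (0 : ℝ) 1) {z : ℂ}
    (hz : z ∈ Metric.ball (0 : ℂ) 1) : 1 - t ≤ ‖1 - (t : ℂ) * z‖ := by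
  rw [mem_ball_zero_iff] at hz
  have h1 : ‖(t : ℂ) * z‖ ≤ t := by
    rw [norm_mul, Complex.norm_real, Real.norm_eq_abs, abs_of_nonneg ht.1]
    exact mul_le_of_le_one_right ht.1 hz.le
  have h2 := norm_sub_norm_le (1 : ℂ) ((t : ℂ) * z)
  rw [norm_one] at h2
  linarith

theorem denom_ne {t : ℝ} (ht : t ∈ Set.Ico (0 : ℝ) 1) {z : ℂ}
    (hz : z ∈ Metric.ball (0 : ℂ) 1) : 1 - (t : ℂ) * z ≠ 0 :=
  norm_pos_iff.1 (lt_of_lt_of_le (by linarith [ht.2]) (denom_bound ht hz))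

theorem differentiableOn_integrand {t : ℝ} (ht : t ∈ Set.Ico (0 : ℝ) 1) {f : ℂ → ℂ}
    (hf : f ∈ holo) :
    DifferentiableOn ℂ (fun ζ => f ζ / (1 - t * ζ)) (Metric.ball 0 1) :=
  hf.1.div (by fun_prop) fun _ hz => denom_ne ht hz

theorem intervalIntegrable_integrand {t : ℝ} (ht : t ∈ Set.Ico (0 : ℝ) 1) {f : ℂ → ℂ}
    (hf : f ∈ holo) {z : ℂ} (hz : z ∈ Metric.ball (0 : ℂ) 1) :
    IntervalIntegrable (fun s : ℝ => f (s * z) / (1 - t * (s * z)) * z)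
      MeasureTheory.volume 0 1 := by
  apply ContinuousOn.intervalIntegrable
  rw [Set.uIcc_of_le zero_le_one]
  refine ContinuousOn.mul ?_ continuousOn_const
  exact (differentiableOn_integrand ht hf).continuousOn.comp
    (f := fun s : ℝ => (s : ℂ) * z) (by fun_prop) fun s hs => segment_mem hz hs

theorem cesaroFun_mem_holo {t : ℝ} (ht : t ∈ Set.Ico (0 : ℝ) 1) {f : ℂ → ℂ} (hf : f ∈ holo) :
    cesaroFun t f ∈ holo := by
  refine ⟨?_, fun z hz => cesaroFun_of_notMem t f hz⟩
  have h0 : (0 : ℂ) ∈ Metric.ball (0 : ℂ) 1 := by simp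
  obtain ⟨G, hG⟩ := (differentiableOn_integrand ht hf).isExactOn_ball
  have hd : DifferentiableOn ℂ (dslope G 0) (Metric.ball 0 1) :=
    (Complex.differentiableOn_dslope (Metric.isOpen_ball.mem_nhds h0)).2
      fun z hz => (hG z hz).differentiableAt.differentiableWithinAt
  refine hd.congr fun z hz => ?_
  by_cases hz0 : z = 0
  · subst hz0
    rw [cesaroFun_zero, dslope_same, (hG 0 h0).deriv]
    simp
  · rw [cesaroFun_of_mem t f hz hz0, dslope_of_ne _ hz0, slope_def_field]
    have h1 : ∀ s ∈ Set.uIcc (0 : ℝ) 1, HasDerivAt (fun s : ℝ => G (s * z))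
        (f (s * z) / (1 - t * (s * z)) * z) s := by
      intro s hs
      rw [Set.uIcc_of_le zero_le_one] at hs
      have h2 : HasDerivAt (fun s : ℝ => (s : ℂ) * z) z s := by
        simpa using (Complex.ofRealCLM.hasDerivAt (x := s)).mul_const z
      exact (hG _ (segment_mem hz hs)).comp s h2
    rw [intervalIntegral.integral_eq_sub_of_hasDerivAt h1 (intervalIntegrable_integrand ht hf hz)]
    simp only [Complex.ofReal_one, Complex.ofReal_zero, one_mul, zero_mul, sub_zero]
    rw [one_div, inv_mul_eq_div]

theorem cesaroFun_bound {t : ℝ} (ht : t ∈ Set.Ico (0 : ℝ) 1) {f : ℂ → ℂ} {k : ℕ}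
    {B : ℝ} (hB : ∀ z ∈ Metric.ball (0 : ℂ) 1, weight z ^ k * ‖f z‖ ≤ B)
    {z : ℂ} (hz : z ∈ Metric.ball (0 : ℂ) 1) :
    weight z ^ k * ‖cesaroFun t f z‖ ≤ (1 - t)⁻¹ * B := by
  have ht1 : 0 < 1 - t := by linarith [ht.2]
  have hw : 0 < weight z ^ k := pow_pos (weight_pos hz) k
  have hf : ∀ s ∈ Set.Icc (0 : ℝ) 1, ‖f (s * z)‖ ≤ B / weight z ^ k := by
    intro s hs
    rw [le_div_iff₀ hw, mul_comm]
    refine le_trans (mul_le_mul_of_nonneg_right ?_ (norm_nonneg _)) (hB _ (segment_mem hz hs))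
    exact pow_le_pow_left₀ (weight_pos hz).le (weight_anti (segment_norm_le hs) hz) k
  have hB0 : 0 ≤ B / weight z ^ k :=
    le_trans (norm_nonneg _) (hf 1 ⟨zero_le_one, le_rfl⟩)
  have key : ‖cesaroFun t f z‖ ≤ B / weight z ^ k / (1 - t) := by
    by_cases hz0 : z = 0
    · have h1 := hf 1 ⟨zero_le_one, le_rfl⟩
      rw [Complex.ofReal_one, one_mul] at h1
      have h2 : cesaroFun t f z = f z := by rw [hz0, cesaroFun_zero]
      rw [h2]
      exact h1.trans (le_div_self hB0 ht1 (by linarith [ht.1]))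
    · have hz1 : 0 < ‖z‖ := norm_pos_iff.2 hz0
      rw [cesaroFun_of_mem t f hz hz0, norm_mul, norm_div, norm_one, one_div,
        inv_mul_le_iff₀ hz1]
      have h3 := intervalIntegral.norm_integral_le_of_norm_le_const (a := (0 : ℝ)) (b := 1)
        (f := fun s : ℝ => f (s * z) / (1 - t * (s * z)) * z)
        (C := ‖z‖ * (B / weight z ^ k / (1 - t))) ?_
      · simpa using h3
      · intro s hs
        rw [Set.uIoc_of_le zero_le_one] at hs
        have hs' : s ∈ Set.Icc (0 : ℝ) 1 := ⟨hs.1.le, hs.2⟩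
        rw [norm_mul, norm_div, mul_comm]
        exact mul_le_mul_of_nonneg_left
          (div_le_div₀ hB0 (hf s hs') ht1 (denom_bound ht (segment_mem hz hs'))) hz1.le
  have h4 := mul_le_mul_of_nonneg_left key hw.le
  refine h4.trans (le_of_eq ?_)
  field_simp

theorem cesaroFun_mem_step {t : ℝ} (ht : t ∈ Set.Ico (0 : ℝ) 1) {f : ℂ → ℂ} {k : ℕ}
    (hf : f ∈ stepSubmodule k) : cesaroFun t f ∈ stepSubmodule k := by
  obtain ⟨hf0, B, hB⟩ := hf
  refine ⟨cesaroFun_mem_holo ht hf0, (1 - t)⁻¹ * B, ?_⟩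
  rintro _ ⟨z, rfl⟩
  exact cesaroFun_bound ht (fun w hw => hB ⟨⟨w, hw⟩, rfl⟩) z.2

theorem cesaroFun_add {t : ℝ} (ht : t ∈ Set.Ico (0 : ℝ) 1) {f g : ℂ → ℂ}
    (hf : f ∈ holo) (hg : g ∈ holo) : cesaroFun t (f + g) = cesaroFun t f + cesaroFun t g := by
  funext z
  rw [Pi.add_apply]
  by_cases hz : z ∈ Metric.ball (0 : ℂ) 1
  · by_cases hz0 : z = 0
    · subst hz0
      simp [cesaroFun_zero]
    · rw [cesaroFun_of_mem t _ hz hz0, cesaroFun_of_mem t _ hz hz0, cesaroFun_of_mem t _ hz hz0,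
        ← mul_add, ← intervalIntegral.integral_add (intervalIntegrable_integrand ht hf hz)
          (intervalIntegrable_integrand ht hg hz)]
      simp only [Pi.add_apply, add_div, add_mul]
  · simp [cesaroFun_of_notMem t _ hz]

theorem cesaroFun_smul (t : ℝ) (c : ℂ) (f : ℂ → ℂ) :
    cesaroFun t (c • f) = c • cesaroFun t f := by
  funext z
  rw [Pi.smul_apply, smul_eq_mul]
  by_cases hz : z ∈ Metric.ball (0 : ℂ) 1
  · by_cases hz0 : z = 0
    · subst hz0
      simp [cesaroFun_zero]
    · rw [cesaroFun_of_mem t _ hz hz0, cesaroFun_of_mem t _ hz hz0, mul_left_comm]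
      congr 1
      rw [← intervalIntegral.integral_const_mul]
      simp only [Pi.smul_apply, smul_eq_mul, mul_div_assoc, mul_assoc]
  · simp [cesaroFun_of_notMem t _ hz]

/-- The generalized Cesàro operator on a weighted space. -/
def cesaroStep (t : ℝ) (ht : t ∈ Set.Ico (0 : ℝ) 1) (k : ℕ) : Step k →L[ℂ] Step k :=
  LinearMap.mkContinuous
    { toFun := fun f => ⟨cesaroFun t f.1, cesaroFun_mem_step ht f.2⟩
      map_add' := fun f g => Subtype.ext (cesaroFun_add ht f.2.1 g.2.1)
      map_smul' := fun c f => Subtype.ext (cesaroFun_smul t c f.1) }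
    (1 - t)⁻¹ fun f => Step.norm_le fun _ hz =>
      cesaroFun_bound ht (fun _ hw => Step.le_norm f hw) hz

/-- The generalized Cesàro operator on `VH(𝔻)`, as a linear map. -/
def cesaroLinear (t : ℝ) (ht : t ∈ Set.Ico (0 : ℝ) 1) : VH →ₗ[ℂ] VH where
  toFun f := ⟨cesaroFun t f.1, f.2.imp fun _ h => ⟨h.1, cesaroFun_mem_step ht h.2⟩⟩
  map_add' f g := Subtype.ext <|
    cesaroFun_add ht (f.2.choose_spec.2).1 (g.2.choose_spec.2).1
  map_smul' c f := Subtype.ext (cesaroFun_smul t c f.1)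

/-- The generalized Cesàro operator `C_t`, `0 ≤ t < 1`, as a continuous operator on `VH(𝔻)`. -/
def cesaro (t : ℝ) (ht : t ∈ Set.Ico (0 : ℝ) 1) : VH →L[ℂ] VH where
  toLinearMap := cesaroLinear t ht
  cont := VH.continuous_of_incl (cesaroLinear t ht) fun k hk =>
    (VH.continuous_incl k hk).comp (cesaroStep t ht k).continuous

theorem cesaro_toFun (t : ℝ) (ht : t ∈ Set.Ico (0 : ℝ) 1) (f : VH) :
    (cesaro t ht f).toFun = cesaroFun t f.toFun := rfl

/-- The point spectrum of a continuous operator: the `μ` for which `μ I - T` is not injective. -/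
def pointSpectrum {E : Type*} [AddCommGroup E] [Module ℂ E] [TopologicalSpace E]
    [IsTopologicalAddGroup E] [ContinuousConstSMul ℂ E] (T : E →L[ℂ] E) : Set ℂ :=
  {μ | ¬ Function.Injective (μ • ContinuousLinearMap.id ℂ E - T)}

end

end LogGrowth

/-!
Write `A_N f (z) = ∫₀¹ s ^ N f(s z) / (1 - t s z) ds`, so that `A_0` is the Cesàro operator and
`A_N (z f) = z A_{N+1} f` (`cesaroAvg_mul_id`). On each weighted Banach space `A_N` has norm at most
`1 / ((N + 1) (1 - t))`, and `(1 - t z) ^ (-(N + 1))` is an eigenfunction of `A_N` with eigenvalue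
`1 / (N + 1)` (`cesaroAvg_eigenFun`). Consequently `z ^ m (1 - t z) ^ (-(m + 1))` is an eigenfunction
of `A_0` with eigenvalue `1 / (m + 1)`.

Let `μ` be neither `0` nor one of the numbers `1 / (m + 1)`. For large `N` the operator `μ - A_N` is
invertible by a Neumann series, the weighted spaces being complete. Splitting off the eigenfunction
of `A_N` from a function `f` leaves a multiple of `z`, on which `A_N` acts like `A_{N+1}`; so
invertibility of `μ - A_{N+1}` gives that of `μ - A_N` (`bijective_smul_sub_avgStep_of_succ`), and
one descends to `N = 0`. The inverses on the weighted spaces fit together to a continuous inverse on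
the inductive limit (`isUnit_smul_sub_cesaro`).

The value `0` is treated through `(z C_t f)' = f / (1 - t z)`. This formula shows that the Cesàro
operator is injective, and that a preimage of `log (1 - z)` would be
`(1 - t z) (log (1 - z) - z / (1 - z))`, which is not of logarithmic growth, so that the operator is
not surjective (`not_surjective_cesaro`).
-/

namespace LogGrowth

noncomputable section

open MeasureTheory Metric Filter Topology

/-! ### Weighted averages along radii -/

/-- The weighted average `∫₀¹ s ^ N φ(s z) ds` of `φ` along the segment from `0` to `z`. -/
def radialMoment (N : ℕ) (φ : ℂ → ℂ) (z : ℂ) : ℂ :=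
  ∫ s in (0 : ℝ)..1, (s : ℂ) ^ N * φ (s * z)

theorem continuousOn_radial {φ : ℂ → ℂ} (hφ : ContinuousOn φ (ball 0 1)) (N : ℕ) {z : ℂ}
    (hz : z ∈ ball (0 : ℂ) 1) :
    ContinuousOn (fun s : ℝ => (s : ℂ) ^ N * φ (s * z)) (Set.Icc 0 1) := by
  refine ContinuousOn.mul (by fun_prop) ?_
  exact hφ.comp (f := fun s : ℝ => (s : ℂ) * z) (by fun_prop) fun s hs => segment_mem hz hs

theorem intervalIntegrable_radial {φ : ℂ → ℂ} (hφ : ContinuousOn φ (ball 0 1)) (N : ℕ) {z : ℂ}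
    (hz : z ∈ ball (0 : ℂ) 1) :
    IntervalIntegrable (fun s : ℝ => (s : ℂ) ^ N * φ (s * z)) volume 0 1 := by
  apply ContinuousOn.intervalIntegrable
  rw [Set.uIcc_of_le zero_le_one]
  exact continuousOn_radial hφ N hz

theorem differentiableOn_radialMoment {φ : ℂ → ℂ} (hφ : DifferentiableOn ℂ φ (ball 0 1))
    (N : ℕ) : DifferentiableOn ℂ (radialMoment N φ) (ball 0 1) := by
  intro z hz
  obtain ⟨ρ, h1, h2⟩ := exists_between (mem_ball_zero_iff.1 hz)
  have hd : DifferentiableOn ℂ (deriv φ) (ball 0 1) := hφ.deriv isOpen_ball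
  obtain ⟨M, hM⟩ := (isCompact_closedBall (0 : ℂ) ρ).exists_bound_of_continuousOn
    (hd.continuousOn.mono (closedBall_subset_ball h2))
  have hI : Set.uIoc (0 : ℝ) 1 ⊆ Set.Icc 0 1 := by
    rw [Set.uIoc_of_le zero_le_one]
    exact Set.Ioc_subset_Icc_self
  have hball : ball (0 : ℂ) ρ ⊆ ball 0 1 := ball_subset_ball h2.le
  have hnhds : ball (0 : ℂ) ρ ∈ 𝓝 z := isOpen_ball.mem_nhds (mem_ball_zero_iff.2 h1)
  refine (intervalIntegral.hasDerivAt_integral_of_dominated_loc_of_deriv_le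
    (F := fun (z : ℂ) (s : ℝ) => (s : ℂ) ^ N * φ (s * z))
    (F' := fun (z : ℂ) (s : ℝ) => (s : ℂ) ^ N * (deriv φ (s * z) * s)) (bound := fun _ => M)
    hnhds ?_ (intervalIntegrable_radial hφ.continuousOn N hz) ?_ ?_
    intervalIntegrable_const ?_).2.differentiableAt.differentiableWithinAt
  · filter_upwards [hnhds] with w hw
    exact ((continuousOn_radial hφ.continuousOn N (hball hw)).mono hI).aestronglyMeasurable
      measurableSet_uIoc
  · refine (ContinuousOn.mono ?_ hI).aestronglyMeasurable measurableSet_uIoc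
    refine ContinuousOn.mul (by fun_prop) (ContinuousOn.mul ?_ (by fun_prop))
    exact hd.continuousOn.comp (f := fun s : ℝ => (s : ℂ) * z) (by fun_prop)
      fun s hs => segment_mem hz hs
  · refine ae_of_all _ fun s hs w hw => ?_
    have hs' := hI hs
    have hs1 : ‖(s : ℂ)‖ ≤ 1 := by
      rw [Complex.norm_real, Real.norm_eq_abs, abs_of_nonneg hs'.1]
      exact hs'.2
    have hw' : ‖deriv φ (s * w)‖ ≤ M := by
      refine hM _ (mem_closedBall_zero_iff.2 ?_)
      exact (segment_norm_le hs').trans (mem_ball_zero_iff.1 hw).le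
    rw [norm_mul, norm_mul, norm_pow]
    calc ‖(s : ℂ)‖ ^ N * (‖deriv φ (s * w)‖ * ‖(s : ℂ)‖)
        ≤ 1 * (‖deriv φ (s * w)‖ * 1) := by
          gcongr
          exact pow_le_one₀ (norm_nonneg _) hs1
      _ ≤ M := by simpa using hw'
  · refine ae_of_all _ fun s hs w hw => ?_
    have h3 : HasDerivAt (fun w : ℂ => (s : ℂ) * w) s w := by
      simpa using (hasDerivAt_id w).const_mul (s : ℂ)
    have h4 : HasDerivAt φ (deriv φ (s * w)) (s * w) :=
      ((hφ _ (segment_mem (hball hw) (hI hs))).differentiableAt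
        (isOpen_ball.mem_nhds (segment_mem (hball hw) (hI hs)))).hasDerivAt
    exact (h4.comp w h3).const_mul _

theorem norm_radialMoment_le {φ : ℂ → ℂ} {z : ℂ} {B : ℝ} (N : ℕ)
    (hB : ∀ s ∈ Set.Icc (0 : ℝ) 1, ‖φ (s * z)‖ ≤ B) : ‖radialMoment N φ z‖ ≤ B / (N + 1) := by
  have h := intervalIntegral.norm_integral_le_of_norm_le (a := (0 : ℝ)) (b := 1) (μ := volume)
    (f := fun s : ℝ => (s : ℂ) ^ N * φ (s * z)) (g := fun s => s ^ N * B) zero_le_one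
    (ae_of_all _ fun s hs => by
      rw [norm_mul, norm_pow, Complex.norm_real, Real.norm_eq_abs, abs_of_nonneg hs.1.le]
      exact mul_le_mul_of_nonneg_left (hB s ⟨hs.1.le, hs.2⟩) (pow_nonneg hs.1.le N))
    (by apply Continuous.intervalIntegrable; fun_prop)
  refine h.trans (le_of_eq ?_)
  rw [intervalIntegral.integral_mul_const, integral_pow]
  simp
  ring

/-- The `N`-th Cesàro average `∫₀¹ s ^ N f(s z) / (1 - t s z) ds`, extended by zero outside the
disc. It describes the action of the Cesàro operator on the multiples of `z ^ N`. -/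
def cesaroAvg (t : ℝ) (N : ℕ) (f : ℂ → ℂ) (z : ℂ) : ℂ :=
  open Classical in
  if z ∈ ball (0 : ℂ) 1 then radialMoment N (fun ζ => f ζ / (1 - t * ζ)) z else 0

theorem cesaroAvg_of_mem (t : ℝ) (N : ℕ) (f : ℂ → ℂ) {z : ℂ} (hz : z ∈ ball (0 : ℂ) 1) :
    cesaroAvg t N f z = radialMoment N (fun ζ => f ζ / (1 - t * ζ)) z := if_pos hz

theorem cesaroAvg_of_notMem (t : ℝ) (N : ℕ) (f : ℂ → ℂ) {z : ℂ} (hz : z ∉ ball (0 : ℂ) 1) :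
    cesaroAvg t N f z = 0 := if_neg hz

theorem cesaroAvg_zero_eq (t : ℝ) (f : ℂ → ℂ) : cesaroAvg t 0 f = cesaroFun t f := by
  funext z
  by_cases hz : z ∈ ball (0 : ℂ) 1
  · rw [cesaroAvg_of_mem t 0 f hz, radialMoment]
    by_cases h0 : z = 0
    · subst h0
      simp [cesaroFun_zero]
    · rw [cesaroFun_of_mem t f hz h0, intervalIntegral.integral_mul_const]
      simp only [pow_zero, one_mul]
      rw [one_div, mul_comm _ z, inv_mul_cancel_left₀ h0]
  · rw [cesaroAvg_of_notMem t 0 f hz, cesaroFun_of_notMem t f hz]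

theorem cesaroAvg_apply_zero (t : ℝ) (N : ℕ) (f : ℂ → ℂ) :
    cesaroAvg t N f 0 = f 0 / (N + 1) := by
  rw [cesaroAvg_of_mem t N f (by simp), radialMoment]
  simp only [mul_zero, sub_zero, div_one]
  rw [intervalIntegral.integral_mul_const]
  have h : ∫ s in (0 : ℝ)..1, (s : ℂ) ^ N = ((∫ s in (0 : ℝ)..1, s ^ N : ℝ) : ℂ) := by
    rw [← intervalIntegral.integral_ofReal]
    simp
  rw [h, integral_pow]
  simp
  ring

theorem cesaroAvg_mul_id (t : ℝ) (N : ℕ) (f : ℂ → ℂ) (z : ℂ) :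
    cesaroAvg t N (fun z => z * f z) z = z * cesaroAvg t (N + 1) f z := by
  by_cases hz : z ∈ ball (0 : ℂ) 1
  · rw [cesaroAvg_of_mem t _ _ hz, cesaroAvg_of_mem t _ _ hz, radialMoment, radialMoment,
      ← intervalIntegral.integral_const_mul]
    congr 1
    funext s
    ring
  · rw [cesaroAvg_of_notMem t _ _ hz, cesaroAvg_of_notMem t _ _ hz, mul_zero]

theorem cesaroAvg_mem_holo {t : ℝ} (ht : t ∈ Set.Ico (0 : ℝ) 1) (N : ℕ) {f : ℂ → ℂ}
    (hf : f ∈ holo) : cesaroAvg t N f ∈ holo :=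
  ⟨(differentiableOn_radialMoment (differentiableOn_integrand ht hf) N).congr
    fun _ hz => cesaroAvg_of_mem t N f hz, fun _ hz => cesaroAvg_of_notMem t N f hz⟩

theorem cesaroAvg_bound {t : ℝ} (ht : t ∈ Set.Ico (0 : ℝ) 1) (N : ℕ) {f : ℂ → ℂ} {k : ℕ} {B : ℝ}
    (hB : ∀ z ∈ ball (0 : ℂ) 1, weight z ^ k * ‖f z‖ ≤ B) {z : ℂ} (hz : z ∈ ball (0 : ℂ) 1) :
    weight z ^ k * ‖cesaroAvg t N f z‖ ≤ (1 - t)⁻¹ / (N + 1) * B := by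
  have ht1 : 0 < 1 - t := by linarith [ht.2]
  have hw : 0 < weight z ^ k := pow_pos (weight_pos hz) k
  have hf : ∀ s ∈ Set.Icc (0 : ℝ) 1, ‖f (s * z)‖ ≤ B / weight z ^ k := by
    intro s hs
    rw [le_div_iff₀ hw, mul_comm]
    refine le_trans (mul_le_mul_of_nonneg_right ?_ (norm_nonneg _)) (hB _ (segment_mem hz hs))
    exact pow_le_pow_left₀ (weight_pos hz).le (weight_anti (segment_norm_le hs) hz) k
  have hB0 : 0 ≤ B / weight z ^ k := le_trans (norm_nonneg _) (hf 1 ⟨zero_le_one, le_rfl⟩)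
  have key := norm_radialMoment_le (φ := fun ζ => f ζ / (1 - t * ζ)) (z := z)
    (B := B / weight z ^ k / (1 - t)) N fun s hs => by
      rw [norm_div]
      exact div_le_div₀ hB0 (hf s hs) ht1 (denom_bound ht (segment_mem hz hs))
  rw [cesaroAvg_of_mem t N f hz]
  refine (mul_le_mul_of_nonneg_left key hw.le).trans (le_of_eq ?_)
  field_simp

theorem cesaroAvg_mem_step {t : ℝ} (ht : t ∈ Set.Ico (0 : ℝ) 1) (N : ℕ) {f : ℂ → ℂ} {k : ℕ}
    (hf : f ∈ stepSubmodule k) : cesaroAvg t N f ∈ stepSubmodule k := by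
  obtain ⟨hf0, B, hB⟩ := hf
  refine ⟨cesaroAvg_mem_holo ht N hf0, (1 - t)⁻¹ / (N + 1) * B, ?_⟩
  rintro _ ⟨z, rfl⟩
  exact cesaroAvg_bound ht N (fun w hw => hB ⟨⟨w, hw⟩, rfl⟩) z.2

theorem cesaroAvg_add {t : ℝ} (ht : t ∈ Set.Ico (0 : ℝ) 1) (N : ℕ) {f g : ℂ → ℂ}
    (hf : f ∈ holo) (hg : g ∈ holo) :
    cesaroAvg t N (f + g) = cesaroAvg t N f + cesaroAvg t N g := by
  funext z
  rw [Pi.add_apply]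
  by_cases hz : z ∈ ball (0 : ℂ) 1
  · rw [cesaroAvg_of_mem t N _ hz, cesaroAvg_of_mem t N _ hz, cesaroAvg_of_mem t N _ hz,
      radialMoment, radialMoment, radialMoment, ← intervalIntegral.integral_add
        (intervalIntegrable_radial (differentiableOn_integrand ht hf).continuousOn N hz)
        (intervalIntegrable_radial (differentiableOn_integrand ht hg).continuousOn N hz)]
    simp only [Pi.add_apply, add_div, mul_add]
  · simp [cesaroAvg_of_notMem t N _ hz]

theorem cesaroAvg_smul (t : ℝ) (N : ℕ) (c : ℂ) (f : ℂ → ℂ) :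
    cesaroAvg t N (c • f) = c • cesaroAvg t N f := by
  funext z
  rw [Pi.smul_apply, smul_eq_mul]
  by_cases hz : z ∈ ball (0 : ℂ) 1
  · rw [cesaroAvg_of_mem t N _ hz, cesaroAvg_of_mem t N _ hz, radialMoment, radialMoment,
      ← intervalIntegral.integral_const_mul]
    simp only [Pi.smul_apply, smul_eq_mul, mul_div_assoc, mul_left_comm]
  · simp [cesaroAvg_of_notMem t N _ hz]

/-- The `N`-th Cesàro average as an operator on a weighted space. -/
def avgStep (t : ℝ) (ht : t ∈ Set.Ico (0 : ℝ) 1) (N k : ℕ) : Step k →L[ℂ] Step k :=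
  LinearMap.mkContinuous
    { toFun := fun f => ⟨cesaroAvg t N f.1, cesaroAvg_mem_step ht N f.2⟩
      map_add' := fun f g => Subtype.ext (cesaroAvg_add ht N f.2.1 g.2.1)
      map_smul' := fun c f => Subtype.ext (cesaroAvg_smul t N c f.1) }
    ((1 - t)⁻¹ / (N + 1)) fun f => Step.norm_le fun _ hz =>
      cesaroAvg_bound ht N (fun _ hw => Step.le_norm f hw) hz

theorem norm_avgStep_le (t : ℝ) (ht : t ∈ Set.Ico (0 : ℝ) 1) (N k : ℕ) :
    ‖avgStep t ht N k‖ ≤ (1 - t)⁻¹ / (N + 1) :=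
  LinearMap.mkContinuous_norm_le _
    (div_nonneg (inv_nonneg.2 (by linarith [ht.2])) (by positivity)) _

/-! ### Completeness of the weighted spaces -/

theorem Step.ext {k : ℕ} {f g : Step k} (h : ∀ z ∈ ball (0 : ℂ) 1, f.toFun z = g.toFun z) :
    f = g := by
  refine Subtype.ext (funext fun z => ?_)
  by_cases hz : z ∈ ball (0 : ℂ) 1
  · exact h z hz
  · exact (f.2.1.2 z hz).trans (g.2.1.2 z hz).symm

/-- The element of a weighted space with a given underlying function. -/
def Step.mk {k : ℕ} (f : ℂ → ℂ) (hf : f ∈ stepSubmodule k) : Step k := ⟨f, hf⟩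

theorem Step.norm_sub_apply_le {k : ℕ} (f g : Step k) {w z : ℂ} (hwz : ‖w‖ ≤ ‖z‖)
    (hz : z ∈ ball (0 : ℂ) 1) : weight z ^ k * ‖f.toFun w - g.toFun w‖ ≤ ‖f - g‖ := by
  have hw : w ∈ ball (0 : ℂ) 1 :=
    mem_ball_zero_iff.2 (hwz.trans_lt (mem_ball_zero_iff.1 hz))
  refine le_trans (mul_le_mul_of_nonneg_right ?_ (norm_nonneg _)) (Step.le_norm (f - g) hw)
  exact pow_le_pow_left₀ (weight_pos hz).le (weight_anti hwz hz) k

instance (k : ℕ) : CompleteSpace (Step k) := by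
  refine Metric.complete_of_cauchySeq_tendsto fun u hu => ?_
  have hcauchy : ∀ z : ℂ, CauchySeq fun n => (u n).toFun z := by
    intro z
    by_cases hz : z ∈ ball (0 : ℂ) 1
    · have hw : 0 < weight z ^ k := pow_pos (weight_pos hz) k
      rw [Metric.cauchySeq_iff] at hu ⊢
      intro ε hε
      obtain ⟨n₀, hn₀⟩ := hu (weight z ^ k * ε) (mul_pos hw hε)
      refine ⟨n₀, fun m hm n hn => ?_⟩
      have h1 := hn₀ m hm n hn
      rw [dist_eq_norm] at h1 ⊢
      exact lt_of_mul_lt_mul_left ((Step.norm_sub_apply_le _ _ le_rfl hz).trans_lt h1) hw.le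
    · have h0 : (fun n => (u n).toFun z) = fun _ => 0 := funext fun n => (u n).2.1.2 z hz
      rw [h0]
      exact cauchySeq_const 0
  choose f hf using fun z => cauchySeq_tendsto_of_complete (hcauchy z)
  have hunif : ∀ ε > 0, ∃ n₀, ∀ n ≥ n₀, ∀ w z : ℂ, ‖w‖ ≤ ‖z‖ → z ∈ ball (0 : ℂ) 1 →
      weight z ^ k * ‖(u n).toFun w - f w‖ ≤ ε := by
    intro ε hε
    obtain ⟨n₀, hn₀⟩ := Metric.cauchySeq_iff.1 hu ε hε
    refine ⟨n₀, fun n hn w z hwz hz => ?_⟩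
    refine le_of_tendsto ((((hf w).const_sub _).norm).const_mul _)
      (eventually_atTop.2 ⟨n₀, fun m hm => ?_⟩)
    refine (Step.norm_sub_apply_le (u n) (u m) hwz hz).trans ?_
    rw [← dist_eq_norm]
    exact (hn₀ n hn m hm).le
  have hlu : TendstoLocallyUniformlyOn (fun n => (u n).toFun) f atTop (ball 0 1) := by
    rw [Metric.tendstoLocallyUniformlyOn_iff]
    intro ε hε z hz
    obtain ⟨ρ, h1, h2⟩ := exists_between (mem_ball_zero_iff.1 hz)
    have hρ0 : 0 ≤ ρ := (norm_nonneg z).trans h1.le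
    have hρn : ‖(ρ : ℂ)‖ = ρ := by
      rw [Complex.norm_real, Real.norm_eq_abs, abs_of_nonneg hρ0]
    have hρ : (ρ : ℂ) ∈ ball (0 : ℂ) 1 := by rw [mem_ball_zero_iff, hρn]; exact h2
    have hw : 0 < weight (ρ : ℂ) ^ k := pow_pos (weight_pos hρ) k
    obtain ⟨n₀, hn₀⟩ := hunif (weight (ρ : ℂ) ^ k * (ε / 2)) (by positivity)
    refine ⟨ball 0 ρ, mem_nhdsWithin_of_mem_nhds
      (isOpen_ball.mem_nhds (mem_ball_zero_iff.2 h1)),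
      eventually_atTop.2 ⟨n₀, fun n hn w hwρ => ?_⟩⟩
    have h3 := le_of_mul_le_mul_left
      (hn₀ n hn w ρ (by rw [hρn]; exact (mem_ball_zero_iff.1 hwρ).le) hρ) hw
    rw [dist_comm, dist_eq_norm]
    linarith
  have hholo : f ∈ holo := by
    refine ⟨hlu.differentiableOn (Eventually.of_forall fun n => (u n).2.1.1) isOpen_ball,
      fun z hz => ?_⟩
    have h0 : (fun n => (u n).toFun z) = fun _ => 0 := funext fun n => (u n).2.1.2 z hz
    have := hf z
    rw [h0] at this
    exact tendsto_nhds_unique this tendsto_const_nhds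
  have hmem : f ∈ stepSubmodule k := by
    obtain ⟨n₀, hn₀⟩ := hunif 1 one_pos
    refine ⟨hholo, 1 + ‖u n₀‖, ?_⟩
    rintro _ ⟨z, rfl⟩
    have h1 := hn₀ n₀ le_rfl z z le_rfl z.2
    have h2 := Step.le_norm (u n₀) z.2
    have h3 : ‖f z‖ ≤ ‖(u n₀).toFun z - f z‖ + ‖(u n₀).toFun z‖ := by
      rw [norm_sub_rev]
      exact norm_le_norm_sub_add _ _
    have h4 := mul_le_mul_of_nonneg_left h3 (pow_nonneg (weight_pos z.2).le k)
    simp only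
    linarith
  refine ⟨Step.mk f hmem, Metric.tendsto_atTop.2 fun ε hε => ?_⟩
  obtain ⟨n₀, hn₀⟩ := hunif (ε / 2) (by positivity)
  refine ⟨n₀, fun n hn => ?_⟩
  rw [dist_eq_norm]
  refine lt_of_le_of_lt (Step.norm_le fun z hz => ?_) (half_lt_self hε)
  exact hn₀ n hn z z le_rfl hz

/-! ### Eigenfunctions, and multiplication and division by the coordinate -/

theorem mem_stepSubmodule_of_bound {f : ℂ → ℂ} (hf : f ∈ holo) {k : ℕ} {B : ℝ}
    (hB : ∀ z ∈ ball (0 : ℂ) 1, weight z ^ k * ‖f z‖ ≤ B) : f ∈ stepSubmodule k :=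
  ⟨hf, B, by rintro _ ⟨z, rfl⟩; exact hB z z.2⟩

theorem weight_pow_mul_le {z : ℂ} (hz : z ∈ ball (0 : ℂ) 1) (k : ℕ) {x : ℝ} (hx : 0 ≤ x) :
    weight z ^ k * x ≤ x :=
  mul_le_of_le_one_left hx (pow_le_one₀ (weight_pos hz).le (weight_le_one hz))

/-- The function `(1 - t z) ^ (-(N + 1))` on the disc, extended by zero. -/
def eigenFun (t : ℝ) (N : ℕ) (z : ℂ) : ℂ :=
  open Classical in if z ∈ ball (0 : ℂ) 1 then ((1 - t * z)⁻¹) ^ (N + 1) else 0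

theorem eigenFun_of_mem (t : ℝ) (N : ℕ) {z : ℂ} (hz : z ∈ ball (0 : ℂ) 1) :
    eigenFun t N z = ((1 - t * z)⁻¹) ^ (N + 1) := if_pos hz

theorem eigenFun_apply_zero (t : ℝ) (N : ℕ) : eigenFun t N 0 = 1 := by
  rw [eigenFun_of_mem t N (by simp)]
  simp

theorem eigenFun_mem_step {t : ℝ} (ht : t ∈ Set.Ico (0 : ℝ) 1) (N k : ℕ) :
    eigenFun t N ∈ stepSubmodule k := by
  have ht1 : 0 < 1 - t := by linarith [ht.2]
  refine mem_stepSubmodule_of_bound (B := ((1 - t)⁻¹) ^ (N + 1)) ⟨?_, fun z hz => if_neg hz⟩ ?_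
  · have h : DifferentiableOn ℂ (fun z : ℂ => ((1 - t * z)⁻¹) ^ (N + 1)) (ball 0 1) :=
      DifferentiableOn.pow (DifferentiableOn.inv (by fun_prop) fun z hz => denom_ne ht hz) _
    exact h.congr fun z hz => eigenFun_of_mem t N hz
  · intro z hz
    refine (weight_pow_mul_le hz k (norm_nonneg _)).trans ?_
    change ‖eigenFun t N z‖ ≤ _
    rw [eigenFun_of_mem t N hz, norm_pow, norm_inv]
    exact pow_le_pow_left₀ (by positivity) (inv_anti₀ ht1 (denom_bound ht hz)) _

/-- The function `(1 - t z) ^ (-(N + 1))` is an eigenfunction of the `N`-th average, because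
`s ^ (N + 1) (1 - t s z) ^ (-(N + 1)) / (N + 1)` is a primitive of the integrand. -/
theorem cesaroAvg_eigenFun {t : ℝ} (ht : t ∈ Set.Ico (0 : ℝ) 1) (N : ℕ) (z : ℂ) :
    cesaroAvg t N (eigenFun t N) z = 1 / ((N : ℂ) + 1) * eigenFun t N z := by
  by_cases hz : z ∈ ball (0 : ℂ) 1
  · have hN : (N : ℂ) + 1 ≠ 0 := Nat.cast_add_one_ne_zero N
    have hderiv : ∀ s ∈ Set.uIcc (0 : ℝ) 1, HasDerivAt
        (fun s : ℝ => 1 / ((N : ℂ) + 1) * ((s : ℂ) ^ (N + 1) * ((1 - t * (s * z))⁻¹) ^ (N + 1)))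
        ((s : ℂ) ^ N * (eigenFun t N (s * z) / (1 - t * (s * z)))) s := by
      intro s hs
      rw [Set.uIcc_of_le zero_le_one] at hs
      have hne := denom_ne ht (segment_mem hz hs)
      have h1 : HasDerivAt (fun s : ℝ => (s : ℂ)) 1 s := Complex.ofRealCLM.hasDerivAt
      have h2 : HasDerivAt (fun s : ℝ => 1 - (t : ℂ) * (s * z)) (-(t * (1 * z))) s :=
        ((h1.mul_const z).const_mul (t : ℂ)).const_sub 1
      have h3 := ((h1.fun_pow (N + 1)).fun_mul ((h2.fun_inv hne).fun_pow (N + 1))).const_mul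
        (1 / ((N : ℂ) + 1))
      refine h3.congr_deriv ?_
      rw [eigenFun_of_mem t N (segment_mem hz hs)]
      push_cast
      generalize hu : (1 : ℂ) - t * (s * z) = u at hne
      have hu' : (t : ℂ) * z * s = 1 - u := by rw [← hu]; ring
      simp only [inv_pow]
      field_simp
      linear_combination (s : ℂ) ^ N * u ^ (N + 1) * hu'
    have hint : IntervalIntegrable
        (fun s : ℝ => (s : ℂ) ^ N * (eigenFun t N (s * z) / (1 - t * (s * z)))) volume 0 1 :=
      intervalIntegrable_radial (φ := fun ζ => eigenFun t N ζ / (1 - t * ζ))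
        (differentiableOn_integrand ht (eigenFun_mem_step ht N 0).1).continuousOn N hz
    rw [cesaroAvg_of_mem t N _ hz, radialMoment,
      intervalIntegral.integral_eq_sub_of_hasDerivAt hderiv hint, eigenFun_of_mem t N hz]
    simp
  · rw [cesaroAvg_of_notMem t N _ hz, eigenFun, if_neg hz, mul_zero]

theorem id_mul_mem_step {f : ℂ → ℂ} {k : ℕ} (hf : f ∈ stepSubmodule k) :
    (fun z => z * f z) ∈ stepSubmodule k := by
  obtain ⟨⟨hd, h0⟩, B, hB⟩ := hf
  refine mem_stepSubmodule_of_bound (B := B)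
    ⟨differentiableOn_id.mul hd, fun z hz => by simp [h0 z hz]⟩ fun z hz => ?_
  refine le_trans (mul_le_mul_of_nonneg_left ?_ (pow_nonneg (weight_pos hz).le k))
    (hB ⟨⟨z, hz⟩, rfl⟩)
  change ‖z * f z‖ ≤ ‖f z‖
  rw [norm_mul]
  exact mul_le_of_le_one_left (norm_nonneg _) (mem_ball_zero_iff.1 hz).le

theorem pow_mul_mem_step {f : ℂ → ℂ} {k : ℕ} (hf : f ∈ stepSubmodule k) (m : ℕ) :
    (fun z => z ^ m * f z) ∈ stepSubmodule k := by
  induction m with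
  | zero => simpa using hf
  | succ m ih =>
    have := id_mul_mem_step ih
    simpa only [pow_succ', mul_assoc] using this

/-- A function of a weighted space that vanishes at the origin is divisible by the coordinate
within that space. -/
theorem exists_eq_id_mul {g : ℂ → ℂ} {k : ℕ} (hg : g ∈ stepSubmodule k) (hg0 : g 0 = 0) :
    ∃ f ∈ stepSubmodule k, ∀ z, g z = z * f z := by
  classical
  obtain ⟨⟨hd, h0⟩, B, hB⟩ := hg
  have hds : DifferentiableOn ℂ (dslope g 0) (ball 0 1) :=
    (Complex.differentiableOn_dslope (isOpen_ball.mem_nhds (by simp))).2 hd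
  obtain ⟨M, hM⟩ := (isCompact_closedBall (0 : ℂ) (1 / 2)).exists_bound_of_continuousOn
    (hds.continuousOn.mono (closedBall_subset_ball (by norm_num)))
  have hmul : ∀ z, g z = z * dslope g 0 z := by
    intro z
    have := sub_smul_dslope g 0 z
    rw [sub_zero, hg0, sub_zero, smul_eq_mul] at this
    exact this.symm
  let f : ℂ → ℂ := fun z => if z ∈ ball (0 : ℂ) 1 then dslope g 0 z else 0
  have hf : ∀ z ∈ ball (0 : ℂ) 1, f z = dslope g 0 z := fun z hz => if_pos hz
  refine ⟨f, mem_stepSubmodule_of_bound (B := max M (2 * B))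
    ⟨hds.congr hf, fun z hz => if_neg hz⟩ fun z hz => ?_, fun z => ?_⟩
  · rw [hf z hz]
    by_cases hz2 : ‖z‖ ≤ 1 / 2
    · exact (weight_pow_mul_le hz k (norm_nonneg _)).trans
        ((hM z (mem_closedBall_zero_iff.2 hz2)).trans (le_max_left _ _))
    · refine le_trans ?_ (le_max_right _ _)
      have h1 : weight z ^ k * ‖g z‖ ≤ B := hB ⟨⟨z, hz⟩, rfl⟩
      have h2 : ‖dslope g 0 z‖ ≤ 2 * ‖g z‖ := by
        have h3 := congrArg norm (hmul z)
        rw [norm_mul] at h3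
        nlinarith [norm_nonneg (dslope g 0 z)]
      have := mul_le_mul_of_nonneg_left h2 (pow_nonneg (weight_pos hz).le k)
      linarith
  · by_cases hz : z ∈ ball (0 : ℂ) 1
    · rw [hf z hz]
      exact hmul z
    · rw [h0 z hz, show f z = 0 from if_neg hz, mul_zero]

theorem cesaroAvg_pow_mul (t : ℝ) (N m : ℕ) (f : ℂ → ℂ) (z : ℂ) :
    cesaroAvg t N (fun z => z ^ m * f z) z = z ^ m * cesaroAvg t (N + m) f z := by
  induction m generalizing N with
  | zero => simp
  | succ m ih =>
    have h : (fun z => z ^ (m + 1) * f z) = fun z => z * (z ^ m * f z) := by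
      funext z
      ring
    rw [h, cesaroAvg_mul_id, ih, pow_succ', mul_assoc, add_assoc, add_comm 1 m]

/-! ### Invertibility on the weighted spaces -/

theorem toFun_smul_sub_avgStep {t : ℝ} (ht : t ∈ Set.Ico (0 : ℝ) 1) (μ : ℂ) (N k : ℕ)
    (f : Step k) (z : ℂ) :
    ((μ • ContinuousLinearMap.id ℂ (Step k) - avgStep t ht N k) f).toFun z
      = μ * f.toFun z - cesaroAvg t N f.toFun z := rfl

/-- For large `N` the norm of the `N`-th average is less than `|μ|`. -/
theorem eventually_bijective_smul_sub_avgStep {t : ℝ} (ht : t ∈ Set.Ico (0 : ℝ) 1) {μ : ℂ}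
    (hμ : μ ≠ 0) (k : ℕ) : ∃ N₀, ∀ N ≥ N₀, Function.Bijective
      (μ • ContinuousLinearMap.id ℂ (Step k) - avgStep t ht N k) := by
  have ht1 : 0 < 1 - t := by linarith [ht.2]
  have hμ' : 0 < ‖μ‖ := norm_pos_iff.2 hμ
  obtain ⟨N₀, hN₀⟩ := exists_nat_gt ((1 - t)⁻¹ / ‖μ‖)
  refine ⟨N₀, fun N hN => ?_⟩
  have hN1 : (1 - t)⁻¹ / (N + 1) < ‖μ‖ := by
    rw [div_lt_iff₀ (by positivity)]
    rw [div_lt_iff₀ hμ'] at hN₀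
    have : (N₀ : ℝ) ≤ N := by exact_mod_cast hN
    nlinarith
  have hlt : ‖avgStep t ht N k‖ * ‖(1 : Step k →L[ℂ] Step k)‖ < ‖μ‖ := by
    refine lt_of_le_of_lt ?_ hN1
    refine (mul_le_of_le_one_right (norm_nonneg _) ContinuousLinearMap.norm_id_le).trans ?_
    exact norm_avgStep_le t ht N k
  have h := spectrum.mem_resolventSet_of_norm_lt_mul hlt
  rw [spectrum.mem_resolventSet_iff, Algebra.algebraMap_eq_smul_one,
    ContinuousLinearMap.isUnit_iff_bijective] at h
  exact h

/-- Invertibility passes from the average of index `N + 1` to that of index `N`, since the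
weighted space is the sum of the line through the eigenfunction and of the multiples of the
coordinate, on which the `N`-th average acts like the next one. -/
theorem bijective_smul_sub_avgStep_of_succ {t : ℝ} (ht : t ∈ Set.Ico (0 : ℝ) 1) {μ : ℂ}
    {N k : ℕ} (hμ : μ ≠ 1 / ((N : ℂ) + 1)) (h : Function.Bijective
      (μ • ContinuousLinearMap.id ℂ (Step k) - avgStep t ht (N + 1) k)) :
    Function.Bijective (μ • ContinuousLinearMap.id ℂ (Step k) - avgStep t ht N k) := by
  constructor
  · rw [injective_iff_map_eq_zero]
    intro f hf
    have hfz : ∀ z, μ * f.toFun z - cesaroAvg t N f.toFun z = 0 := fun z => by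
      rw [← toFun_smul_sub_avgStep ht, hf]
      rfl
    have hf0 : f.toFun 0 = 0 := by
      have h0 := hfz 0
      rw [cesaroAvg_apply_zero] at h0
      have h1 : (μ - 1 / ((N : ℂ) + 1)) * f.toFun 0 = 0 := by
        linear_combination h0
      exact (mul_eq_zero.1 h1).resolve_left (sub_ne_zero.2 hμ)
    obtain ⟨g, hg, hfg⟩ := exists_eq_id_mul f.2 hf0
    have hg0 : Step.mk g hg = 0 := by
      refine (injective_iff_map_eq_zero _).1 h.1 _ ?_
      -- Off the origin the coordinate cancels; the origin itself follows by continuity.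
      have hmem := ((μ • ContinuousLinearMap.id ℂ (Step k) - avgStep t ht (N + 1) k)
        (Step.mk g hg)).2.1.1.continuousOn
      have hoff : ∀ z ≠ 0, ((μ • ContinuousLinearMap.id ℂ (Step k) - avgStep t ht (N + 1) k)
          (Step.mk g hg)).toFun z = 0 := by
        intro z hz
        rw [toFun_smul_sub_avgStep]
        have h1 := hfz z
        rw [show f.toFun = fun z => z * g z from funext hfg, cesaroAvg_mul_id] at h1
        refine (mul_eq_zero.1 (?_ : z * _ = 0)).resolve_left hz
        rw [← h1, show (Step.mk g hg).toFun = g from rfl]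
        ring
      refine Step.ext fun z hz => ?_
      by_cases hz0 : z = 0
      · subst hz0
        have h1 := (hmem.continuousAt (isOpen_ball.mem_nhds hz)).tendsto.mono_left
          (nhdsWithin_le_nhds (s := {0}ᶜ))
        refine tendsto_nhds_unique h1 (tendsto_const_nhds.congr' ?_)
        filter_upwards [self_mem_nhdsWithin] with w hw
        exact (hoff w hw).symm
      · exact hoff z hz0
    refine Step.ext fun z _ => ?_
    have h2 : g z = (Step.mk g hg).toFun z := rfl
    rw [show f.toFun z = z * g z from hfg z, h2, hg0, show (0 : Step k).toFun z = 0 from rfl,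
      mul_zero]
  · intro g
    set c : ℂ := g.toFun 0 with hc
    have he := eigenFun_mem_step ht N k
    have hmem : (g.toFun - c • eigenFun t N) ∈ stepSubmodule k :=
      (stepSubmodule k).sub_mem g.2 ((stepSubmodule k).smul_mem c he)
    obtain ⟨g₁, hg₁, hgg⟩ := exists_eq_id_mul hmem (by simp [eigenFun_apply_zero, hc])
    obtain ⟨f₁, hf₁⟩ := h.2 (Step.mk g₁ hg₁)
    have hf₁z : ∀ z, μ * f₁.toFun z - cesaroAvg t (N + 1) f₁.toFun z = g₁ z := fun z => by
      rw [← toFun_smul_sub_avgStep ht, hf₁]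
      rfl
    have hne : μ - 1 / ((N : ℂ) + 1) ≠ 0 := sub_ne_zero.2 hμ
    set d : ℂ := c / (μ - 1 / ((N : ℂ) + 1)) with hd
    refine ⟨d • Step.mk _ he + Step.mk _ (id_mul_mem_step f₁.2), ?_⟩
    rw [map_add, map_smul]
    refine Step.ext fun z _ => ?_
    have e1 := toFun_smul_sub_avgStep ht μ N k (Step.mk _ he) z
    have e2 := toFun_smul_sub_avgStep ht μ N k (Step.mk _ (id_mul_mem_step f₁.2)) z
    change d * ((μ • ContinuousLinearMap.id ℂ (Step k) - avgStep t ht N k)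
      (Step.mk _ he)).toFun z + ((μ • ContinuousLinearMap.id ℂ (Step k) - avgStep t ht N k)
      (Step.mk _ (id_mul_mem_step f₁.2))).toFun z = _
    rw [e1, e2]
    change d * (μ * eigenFun t N z - cesaroAvg t N (eigenFun t N) z) +
      (μ * (z * f₁.toFun z) - cesaroAvg t N (fun z => z * f₁.toFun z) z) = _
    rw [cesaroAvg_eigenFun ht, cesaroAvg_mul_id]
    have h3 : g.toFun z - c * eigenFun t N z = z * g₁ z := hgg z
    have h4 : d * (μ - 1 / ((N : ℂ) + 1)) = c := div_mul_cancel₀ c hne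
    linear_combination z * hf₁z z - h3 + eigenFun t N z * h4

theorem bijective_smul_sub_avgStep {t : ℝ} (ht : t ∈ Set.Ico (0 : ℝ) 1) {μ : ℂ} (h0 : μ ≠ 0)
    (hμ : ∀ m : ℕ, μ ≠ 1 / ((m : ℂ) + 1)) (N k : ℕ) :
    Function.Bijective (μ • ContinuousLinearMap.id ℂ (Step k) - avgStep t ht N k) := by
  obtain ⟨N₀, hN₀⟩ := eventually_bijective_smul_sub_avgStep ht h0 k
  rcases le_total N₀ N with h | h
  · exact hN₀ N h
  · exact Nat.decreasingInduction' (P := fun n => Function.Bijective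
      (μ • ContinuousLinearMap.id ℂ (Step k) - avgStep t ht n k))
      (fun n _ _ ih => bijective_smul_sub_avgStep_of_succ ht (hμ n) ih) h (hN₀ N₀ le_rfl)

/-! ### Passage to the inductive limit -/

theorem VH.exists_incl (f : VH) : ∃ (k : ℕ) (hk : 1 ≤ k) (g : Step k), VH.incl k hk g = f := by
  obtain ⟨k, hk, h⟩ := f.2
  exact ⟨k, hk, Step.mk f.1 h, rfl⟩

theorem VH.incl_injective (k : ℕ) (hk : 1 ≤ k) : Function.Injective (VH.incl k hk) :=
  fun _ _ h => Subtype.ext (congrArg VH.toFun h)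

theorem smul_sub_cesaro_incl {t : ℝ} (ht : t ∈ Set.Ico (0 : ℝ) 1) (μ : ℂ) (k : ℕ) (hk : 1 ≤ k)
    (f : Step k) :
    (μ • ContinuousLinearMap.id ℂ VH - cesaro t ht) (VH.incl k hk f) =
      VH.incl k hk ((μ • ContinuousLinearMap.id ℂ (Step k) - avgStep t ht 0 k) f) := by
  refine Subtype.ext (funext fun z => ?_)
  change μ * f.toFun z - cesaroFun t f.toFun z = μ * f.toFun z - cesaroAvg t 0 f.toFun z
  rw [cesaroAvg_zero_eq]

theorem bijective_smul_sub_cesaro {t : ℝ} (ht : t ∈ Set.Ico (0 : ℝ) 1) {μ : ℂ} (h0 : μ ≠ 0)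
    (hμ : ∀ m : ℕ, μ ≠ 1 / ((m : ℂ) + 1)) :
    Function.Bijective (μ • ContinuousLinearMap.id ℂ VH - cesaro t ht) := by
  constructor
  · rw [injective_iff_map_eq_zero]
    intro f hf
    obtain ⟨k, hk, g, rfl⟩ := VH.exists_incl f
    rw [smul_sub_cesaro_incl, ← map_zero (VH.incl k hk)] at hf
    have h1 := VH.incl_injective k hk hf
    rw [(injective_iff_map_eq_zero _).1 (bijective_smul_sub_avgStep ht h0 hμ 0 k).1 g h1, map_zero]
  · intro f
    obtain ⟨k, hk, g, rfl⟩ := VH.exists_incl f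
    obtain ⟨u, rfl⟩ := (bijective_smul_sub_avgStep ht h0 hμ 0 k).2 g
    exact ⟨VH.incl k hk u, smul_sub_cesaro_incl ht μ k hk u⟩

/-- The inverse is continuous on each weighted space by the open mapping theorem, hence on the
inductive limit. -/
theorem isUnit_smul_sub_cesaro {t : ℝ} (ht : t ∈ Set.Ico (0 : ℝ) 1) {μ : ℂ} (h0 : μ ≠ 0)
    (hμ : ∀ m : ℕ, μ ≠ 1 / ((m : ℂ) + 1)) :
    IsUnit (μ • ContinuousLinearMap.id ℂ VH - cesaro t ht) := by
  set T := μ • ContinuousLinearMap.id ℂ VH - cesaro t ht with hT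
  let e : VH ≃ₗ[ℂ] VH := LinearEquiv.ofBijective T.toLinearMap (bijective_smul_sub_cesaro ht h0 hμ)
  have he : ∀ f, e f = T f := fun _ => rfl
  have hcont : Continuous e.symm.toLinearMap := by
    refine VH.continuous_of_incl e.symm.toLinearMap fun k hk => ?_
    let R := ContinuousLinearEquiv.ofBijective
      (μ • ContinuousLinearMap.id ℂ (Step k) - avgStep t ht 0 k)
      (LinearMap.ker_eq_bot.2 (bijective_smul_sub_avgStep ht h0 hμ 0 k).1)
      (LinearMap.range_eq_top.2 (bijective_smul_sub_avgStep ht h0 hμ 0 k).2)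
    have hR : ∀ f, (μ • ContinuousLinearMap.id ℂ (Step k) - avgStep t ht 0 k) (R.symm f) = f :=
      fun f => R.apply_symm_apply f
    refine ((VH.continuous_incl k hk).comp R.symm.continuous).congr fun f => ?_
    refine ((LinearEquiv.symm_apply_eq e).2 ?_).symm
    rw [he, Function.comp_apply, hT, smul_sub_cesaro_incl, hR]
  let S : VH →L[ℂ] VH := ⟨e.symm.toLinearMap, hcont⟩
  refine ⟨⟨T, S, ?_, ?_⟩, rfl⟩
  · exact ContinuousLinearMap.ext fun f => e.apply_symm_apply f
  · exact ContinuousLinearMap.ext fun f => e.symm_apply_apply f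

/-! ### The eigenvalues -/

theorem not_injective_smul_sub_cesaro {t : ℝ} (ht : t ∈ Set.Ico (0 : ℝ) 1) (m : ℕ) :
    ¬ Function.Injective
      ((1 / ((m : ℂ) + 1)) • ContinuousLinearMap.id ℂ VH - cesaro t ht) := by
  intro hinj
  let e : Step 1 := Step.mk _ (pow_mul_mem_step (eigenFun_mem_step ht m 1) m)
  have he : VH.incl 1 le_rfl e = 0 := by
    refine (injective_iff_map_eq_zero _).1 hinj _ ?_
    rw [smul_sub_cesaro_incl]
    refine (congrArg _ (Step.ext fun z _ => ?_)).trans (map_zero (VH.incl 1 le_rfl))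
    rw [toFun_smul_sub_avgStep]
    change 1 / ((m : ℂ) + 1) * (z ^ m * eigenFun t m z) -
      cesaroAvg t 0 (fun z => z ^ m * eigenFun t m z) z = 0
    rw [cesaroAvg_pow_mul, zero_add, cesaroAvg_eigenFun ht]
    ring
  have hhalf : (1 / 2 : ℂ) ∈ ball (0 : ℂ) 1 := by
    rw [mem_ball_zero_iff]
    norm_num
  have h1 : (1 / 2 : ℂ) ^ m * eigenFun t m (1 / 2) = 0 :=
    congrFun (congrArg VH.toFun he) (1 / 2)
  rw [eigenFun_of_mem t m hhalf] at h1
  exact mul_ne_zero (pow_ne_zero _ (by norm_num))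
    (pow_ne_zero _ (inv_ne_zero (denom_ne ht hhalf))) h1

/-! ### The value zero -/

/-- The Cesàro operator inverts `f ↦ (1 - t z) (z f)'`. -/
theorem hasDerivAt_mul_cesaroFun {t : ℝ} (ht : t ∈ Set.Ico (0 : ℝ) 1) {f : ℂ → ℂ} (hf : f ∈ holo)
    {z : ℂ} (hz : z ∈ ball (0 : ℂ) 1) :
    HasDerivAt (fun z => z * cesaroFun t f z) (f z / (1 - t * z)) z := by
  obtain ⟨G, hG⟩ := (differentiableOn_integrand ht hf).isExactOn_ball
  refine ((hG z hz).sub_const (G 0)).congr_of_eventuallyEq ?_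
  filter_upwards [isOpen_ball.mem_nhds hz] with w hw
  by_cases hw0 : w = 0
  · simp [hw0]
  rw [cesaroFun_of_mem t f hw hw0, ← mul_assoc, mul_one_div_cancel hw0, one_mul]
  have h1 : ∀ s ∈ Set.uIcc (0 : ℝ) 1, HasDerivAt (fun s : ℝ => G (s * w))
      (f (s * w) / (1 - t * (s * w)) * w) s := by
    intro s hs
    rw [Set.uIcc_of_le zero_le_one] at hs
    have h2 : HasDerivAt (fun s : ℝ => (s : ℂ) * w) w s := by
      simpa using (Complex.ofRealCLM.hasDerivAt (x := s)).mul_const w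
    exact (hG _ (segment_mem hw hs)).comp s h2
  rw [intervalIntegral.integral_eq_sub_of_hasDerivAt h1 (intervalIntegrable_integrand ht hf hw)]
  simp

theorem injective_cesaro {t : ℝ} (ht : t ∈ Set.Ico (0 : ℝ) 1) :
    Function.Injective (cesaro t ht) := by
  rw [injective_iff_map_eq_zero]
  intro f hf
  obtain ⟨k, hk, g, rfl⟩ := VH.exists_incl f
  have h0 : cesaroFun t g.toFun = 0 := congrArg VH.toFun hf
  rw [← map_zero (VH.incl k hk)]
  refine congrArg _ (Step.ext fun z hz => ?_)
  have h1 := hasDerivAt_mul_cesaroFun ht g.2.1 hz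
  rw [show g.1 = g.toFun from rfl, h0] at h1
  simp only [Pi.zero_apply, mul_zero] at h1
  have h2 := h1.unique (hasDerivAt_const z 0)
  exact (div_eq_zero_iff.1 h2).resolve_right (denom_ne ht hz)

theorem weight_mul_neg_log_le_one {z : ℂ} (hz : z ∈ ball (0 : ℂ) 1) :
    weight z * -Real.log (1 - ‖z‖) ≤ 1 := by
  rw [mem_ball_zero_iff] at hz
  unfold weight
  split_ifs with h
  · have h1 : 1 / Real.exp 1 ≤ 1 - ‖z‖ := by linarith
    have h2 := Real.log_le_log (by positivity) h1
    rw [one_div, Real.log_inv, Real.log_exp] at h2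
    linarith
  · have := one_le_neg_log (not_le.1 h).le hz
    rw [inv_mul_cancel₀ (by linarith)]

/-- The function `log (1 - z)` on the disc, extended by zero. -/
def logFun (z : ℂ) : ℂ :=
  open Classical in if z ∈ ball (0 : ℂ) 1 then Complex.log (1 - z) else 0

theorem logFun_of_mem {z : ℂ} (hz : z ∈ ball (0 : ℂ) 1) : logFun z = Complex.log (1 - z) :=
  if_pos hz

theorem one_sub_mem_slitPlane {z : ℂ} (hz : z ∈ ball (0 : ℂ) 1) : 1 - z ∈ Complex.slitPlane := by
  rw [mem_ball_zero_iff] at hz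
  left
  have := (Complex.re_le_norm z).trans_lt hz
  simpa using this

theorem hasDerivAt_logFun {z : ℂ} (hz : z ∈ ball (0 : ℂ) 1) :
    HasDerivAt logFun (-1 / (1 - z)) z := by
  refine (((hasDerivAt_id z).const_sub 1).clog (one_sub_mem_slitPlane hz)).congr_of_eventuallyEq ?_
  filter_upwards [isOpen_ball.mem_nhds hz] with w hw
  exact logFun_of_mem hw

theorem logFun_mem_step : logFun ∈ stepSubmodule 1 := by
  refine mem_stepSubmodule_of_bound (B := 2 + Real.pi)
    ⟨fun z hz => (hasDerivAt_logFun hz).differentiableAt.differentiableWithinAt,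
      fun z hz => if_neg hz⟩ fun z hz => ?_
  have hz1 := mem_ball_zero_iff.1 hz
  have hlow : 1 - ‖z‖ ≤ ‖1 - z‖ := by simpa using norm_sub_norm_le (1 : ℂ) z
  have hup : ‖1 - z‖ ≤ 2 := by
    have := norm_sub_le (1 : ℂ) z
    rw [norm_one] at this
    linarith
  have hpos : 0 < 1 - ‖z‖ := by linarith
  have hre : |Real.log ‖1 - z‖| ≤ -Real.log (1 - ‖z‖) + 1 := by
    have h1 := Real.log_le_log hpos hlow
    have h2 := Real.log_le_sub_one_of_pos (hpos.trans_le hlow)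
    have h3 := Real.log_nonpos hpos.le (by linarith [norm_nonneg z])
    rw [abs_le]
    constructor <;> linarith
  have hlog : ‖logFun z‖ ≤ -Real.log (1 - ‖z‖) + 1 + Real.pi := by
    rw [logFun_of_mem hz]
    refine (Complex.norm_le_abs_re_add_abs_im _).trans ?_
    rw [Complex.log_re, Complex.log_im]
    exact add_le_add hre (Complex.abs_arg_le_pi _)
  have hw := weight_pos hz
  have hw1 := weight_le_one hz
  have h4 := mul_le_mul_of_nonneg_left hlog hw.le
  have h5 := weight_mul_neg_log_le_one hz
  rw [pow_one]
  nlinarith [Real.pi_pos]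

/-- A preimage of `log (1 - z)` would be `(1 - t z) (log (1 - z) - z / (1 - z))`, which grows
faster than every power of the logarithm along the positive radius. -/
theorem not_surjective_cesaro {t : ℝ} (ht : t ∈ Set.Ico (0 : ℝ) 1) :
    ¬ Function.Surjective (cesaro t ht) := by
  intro hsurj
  obtain ⟨f, hf⟩ := hsurj (VH.incl 1 le_rfl (Step.mk logFun logFun_mem_step))
  obtain ⟨k, hk, g, rfl⟩ := VH.exists_incl f
  have hfun : cesaroFun t g.toFun = logFun := congrArg VH.toFun hf
  have ht1 : 0 < 1 - t := by linarith [ht.2]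
  have hval : ∀ z ∈ ball (0 : ℂ) 1,
      g.toFun z = (1 - t * z) * (Complex.log (1 - z) - z / (1 - z)) := by
    intro z hz
    have h1 := hasDerivAt_mul_cesaroFun ht (f := g.toFun) g.2.1 hz
    rw [hfun] at h1
    have h2 := h1.unique ((hasDerivAt_id z).mul (hasDerivAt_logFun hz))
    rw [div_eq_iff (denom_ne ht hz), logFun_of_mem hz] at h2
    rw [h2, id]
    ring
  -- On the positive radius, at `1 - exp (-u)`, the two summands have the same sign.
  have hbound : ∀ u : ℝ, 1 < u →
      (1 - t) * (1 - Real.exp (-u)) ≤ ‖g‖ * (u ^ k * Real.exp (-u)) := by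
    intro u hu
    have hx0 : 0 < Real.exp (-u) := Real.exp_pos _
    have hx1 : Real.exp (-u) < Real.exp (-1) := Real.exp_lt_exp.2 (by linarith)
    have hx2 : Real.exp (-u) < 1 := by
      rw [Real.exp_lt_one_iff]
      linarith
    generalize hx : Real.exp (-u) = x at *
    have hlogx : Real.log x = -u := by rw [← hx, Real.log_exp]
    have hn : ‖((1 - x : ℝ) : ℂ)‖ = 1 - x := by
      rw [Complex.norm_real, Real.norm_eq_abs, abs_of_pos (by linarith)]
    have hz : ((1 - x : ℝ) : ℂ) ∈ ball (0 : ℂ) 1 := by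
      rw [mem_ball_zero_iff, hn]
      linarith
    have hweight : weight ((1 - x : ℝ) : ℂ) = u⁻¹ := by
      rw [weight, if_neg, hn, sub_sub_cancel, hlogx, neg_neg]
      rw [hn, one_div, ← Real.exp_neg]
      linarith
    have hg := Step.le_norm g hz
    have hreal : g.toFun ((1 - x : ℝ) : ℂ) =
        (((1 - t * (1 - x)) * (Real.log x - (1 - x) / x) : ℝ) : ℂ) := by
      rw [hval _ hz]
      push_cast
      rw [sub_sub_cancel, Complex.ofReal_log hx0.le]
    have hlower : (1 - t) * ((1 - x) / x) ≤ ‖g.toFun ((1 - x : ℝ) : ℂ)‖ := by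
      rw [hreal, Complex.norm_real, Real.norm_eq_abs, abs_mul]
      have h1 : 1 - t ≤ |1 - t * (1 - x)| :=
        le_trans (by nlinarith [ht.1]) (le_abs_self _)
      have h2 : (1 - x) / x ≤ |Real.log x - (1 - x) / x| :=
        le_trans (by rw [hlogx]; linarith) (neg_le_abs _)
      exact mul_le_mul h1 h2 (div_nonneg (by linarith) hx0.le) (abs_nonneg _)
    rw [hweight, inv_pow, inv_mul_le_iff₀ (by positivity)] at hg
    have h3 := hlower.trans hg
    rw [mul_div_assoc', div_le_iff₀ hx0] at h3
    linarith
  have hexp : Tendsto (fun u : ℝ => Real.exp (-u)) atTop (𝓝 0) :=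
    Real.tendsto_exp_neg_atTop_nhds_zero
  have hlim1 : Tendsto (fun u : ℝ => (1 - t) * (1 - Real.exp (-u))) atTop (𝓝 (1 - t)) := by
    simpa using (hexp.const_sub 1).const_mul (1 - t)
  have hlim2 : Tendsto (fun u : ℝ => ‖g‖ * (u ^ k * Real.exp (-u))) atTop (𝓝 0) := by
    simpa using (Real.tendsto_pow_mul_exp_neg_atTop_nhds_zero k).const_mul ‖g‖
  have := le_of_tendsto_of_tendsto hlim1 hlim2
    ((eventually_gt_atTop 1).mono fun u hu => hbound u hu)
  linarith

/-! ### The spectra -/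

theorem mem_spectrum_cesaro_iff {t : ℝ} (ht : t ∈ Set.Ico (0 : ℝ) 1) (μ : ℂ) :
    μ ∈ spectrum ℂ (cesaro t ht) ↔
      ¬ IsUnit (μ • ContinuousLinearMap.id ℂ VH - cesaro t ht) := by
  rw [spectrum.mem_iff, Algebra.algebraMap_eq_smul_one]
  rfl

theorem bijective_of_isUnit {T : VH →L[ℂ] VH} (h : IsUnit T) : Function.Bijective T := by
  obtain ⟨u, rfl⟩ := h
  refine Function.bijective_iff_has_inverse.2 ⟨(↑u⁻¹ : VH →L[ℂ] VH), fun f => ?_, fun f => ?_⟩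
  · exact DFunLike.congr_fun u.inv_mul f
  · exact DFunLike.congr_fun u.mul_inv f

end

end LogGrowth

theorem proposition3p5 (t : ℝ) (ht : t ∈ Set.Ico (0 : ℝ) 1) :
    LogGrowth.pointSpectrum (LogGrowth.cesaro t ht) = {μ : ℂ | ∃ m : ℕ, μ = 1 / ((m : ℂ) + 1)} ∧
    spectrum ℂ (LogGrowth.cesaro t ht) = {μ : ℂ | ∃ m : ℕ, μ = 1 / ((m : ℂ) + 1)} ∪ {0} := by
  open LogGrowth in
  constructor
  · ext μ
    constructor
    · intro hμ
      change ¬ Function.Injective (μ • ContinuousLinearMap.id ℂ VH - cesaro t ht) at hμ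
      by_contra hne
      have hne' : ∀ m : ℕ, μ ≠ 1 / ((m : ℂ) + 1) := fun m h => hne ⟨m, h⟩
      refine hμ ?_
      by_cases h0 : μ = 0
      · subst h0
        rw [zero_smul, zero_sub]
        exact neg_injective.comp (injective_cesaro ht)
      · exact (bijective_smul_sub_cesaro ht h0 hne').1
    · rintro ⟨m, rfl⟩
      exact not_injective_smul_sub_cesaro ht m
  · ext μ
    rw [mem_spectrum_cesaro_iff]
    constructor
    · intro hμ
      by_contra hne
      rw [Set.mem_union, not_or] at hne
      exact hμ (isUnit_smul_sub_cesaro ht hne.2 fun m h => hne.1 ⟨m, h⟩)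
    · rintro (⟨m, rfl⟩ | rfl) hu
      · exact not_injective_smul_sub_cesaro ht m (bijective_of_isUnit hu).1
      · refine not_surjective_cesaro ht fun f => ?_
        obtain ⟨g, hg⟩ := (bijective_of_isUnit hu).2 (-f)
        rw [zero_smul, zero_sub, neg_apply, neg_inj] at hg
        exact ⟨g, hg⟩
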